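/- **Setting.** Let $\mathbb X,\mathbb A$ be measurable spaces, $\lambda$ a $\sigma$-finite measure on $\mathbb A$, $\mathbb Y\subseteq\mathbb R$ an unbounded set with its Borel $\sigma$-field, $\mathbb O=\mathbb X\times\mathbb A\times\mathbb Y$, $n\ge 1$, and $g:\mathbb X\times\mathbb A\to\mathbb R$ measurable. For $i=1,\dots,n$ let $\Pi_i(\cdot\mid x,\mathbf o_{i-1})$ be a behaviour policy (a Markov kernel from $\mathbb X\times\mathbb O^{i-1}$ to $\mathbb A$) with jointly measurable $\lambda$-density $\pi_i(x,\mathbf o_{i-1};a)\ge 0$. A problem instance is a pair $\mathcal I=(\Xi,\Gamma)$ of a probability measure $\Xi$ on $\mathbb X$ and a Markov kernel $\Gamma$ from $\mathbb X\times\mathbb A$ to $\mathbb Y$. Under $\mathcal I$ the data $\mathbf O_n=(X_i,A_i,Y_i)_{i\le n}$ are generated sequentially: $X_i\sim\Xi$ independently of the past $\mathbf O_{i-1}$, $A_i\sim\Pi_i(\cdot\mid X_i,\mathbf O_{i-1})$, $Y_i\sim\Gamma(\cdot\mid X_i,A_i)$; $\mathbb E_{\mathcal I}$ is the corresponding expectation.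 Put $\mu(\Gamma)(x,a)=\int y\,\Gamma(dy\mid x,a)$ and $$\tau(\mathcal I)=\mathbb E_{X\sim\Xi}\Big[\int_{\mathbb A} g(X,a)\,\mu(\Gamma)(X,a)\,\lambda(da)\Big].$$ Say that $\tau(\mathcal I)$ is well defined if $\mu(\Gamma)(x,a)$ exists for all $(x,a)$, $g(x,\cdot)\mu(\Gamma)(x,\cdot)\in L^1(\lambda)$ for $\Xi$-a.e. $x$, and the inner integral is $\Xi$-integrable. Fix $\mathcal I^*=(\Xi^*,\Gamma^*)$ with $\tau(\mathcal I^*)$ well defined and such that, for all $(x,a)$, $\Gamma^*(\cdot\mid x,a)$ has mean $\mu^*(x,a)$ and finite variance $\sigma^2(x,a)$. Let $$\|\sigma\|_{(n)}^2=\frac1n\sum_{i=1}^n\mathbb E_{\mathcal I^*}\Big[\frac{g^2(X_i,A_i)\,\sigma^2(X_i,A_i)}{\pi_i^2(X_i,\mathbf O_{i-1};A_i)}\Big],\qquad v_*^2=\mathrm{Var}_{X\sim\Xi^*}\Big[\int_{\mathbb A} g(X,a)\mu^*(X,a)\,\lambda(da)\Big]+\|\sigma\|_{(n)}^2,$$ and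 assume $\|\sigma\|_{(n)}<\infty$. For $\delta:\mathbb X\times\mathbb A\to[0,\infty)$ let $\mathcal C_\delta(\mathcal I^*)$ be the set of instances $(\Xi,\Gamma)$ with $\tau(\Xi,\Gamma)$ well defined, $\mathrm{KL}(\Xi\,\|\,\Xi^*)\le 1/n$, and $|\mu(\Gamma)(x,a)-\mu^*(x,a)|\le\delta(x,a)$ for all $(x,a)$. The local minimax risk is $$\mathcal M_n(\mathcal C_\delta(\mathcal I^*))=\inf_{\hat\tau_n:\mathbb O^n\to\mathbb R\text{ measurable}}\ \sup_{\mathcal I\in\mathcal C_\delta(\mathcal I^*)}\mathbb E_{\mathcal I}\big[(\hat\tau_n(\mathbf O_n)-\tau(\mathcal I))^2\big].$$ **Theorem.** For every $K\in[1,\infty)$ there is a constant $\mathcal C(K)>0$, depending only on $K$, such that in every setting as above $$\mathcal M_n(\mathcal C_\delta(\mathcal I^*))\ \ge\ \mathcal C(K)\cdot\frac{v_*^2}{n},$$ provided that 1. there are Markov reference policies $\overline\Pi_i(\cdot\mid x)$, $i\le n$, with jointly measurable $\lambda$-densities $\overline\pi_i(x,a)$ such that $\frac1K\le\overline\pi_i(x,a)/\pi_i(x,\mathbf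 o_{i-1};a)\le K$ for all $i$ and all $(x,\mathbf o_{i-1},a)$; 2. the function $h(x)=\int_{\mathbb A} g(x,a)\mu^*(x,a)\,\lambda(da)-\tau(\mathcal I^*)$ is in $L^4(\Xi^*)$ and $\sqrt{\mathbb E_{\Xi^*}[h^4]}\,/\,\mathbb E_{\Xi^*}[h^2]<\infty$ (where $0/0=0$); 3. $\sqrt n\,\delta(x,a)\ \ge\ \dfrac{|g(x,a)|\,\sigma^2(x,a)}{\overline\pi_i(x,a)\,\|\sigma\|_{(n)}}$ for all $(x,a)$ and all $i\le n$ (a void condition if $\|\sigma\|_{(n)}=0$). -/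

import Mathlib

open MeasureTheory ProbabilityTheory
open scoped ENNReal

namespace OffPolicy

/-- A context-action-outcome triple; the outcome space is a set `Y` of real numbers. -/
abbrev Obs (X A : Type*) (Y : Set ℝ) : Type _ := X × A × Y

/-- A policy choosing an action from the information in `H`: a Markov kernel from `H` to `A`
together with a (jointly measurable, nonnegative) density with respect to the base measure `lam`. -/
structure Policy (H : Type*) {A : Type*} [MeasurableSpace H] [MeasurableSpace A]
    (lam : Measure A) where
  kernel : Kernel H A
  isMarkov : IsMarkovKernel kernel
  density : H → A → ℝ
  measurable_density : Measurable (Function.uncurry density)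
  density_nonneg : ∀ h a, 0 ≤ density h a
  kernel_eq : ∀ h, kernel h = lam.withDensity (fun a => ENNReal.ofReal (density h a))

/-- A problem instance: a context distribution and an outcome kernel. -/
structure ProblemInstance (X A : Type*) (Y : Set ℝ) [MeasurableSpace X] [MeasurableSpace A] where
  ctx : Measure X
  isProb : IsProbabilityMeasure ctx
  out : Kernel (X × A) Y
  isMarkov : IsMarkovKernel out

section

variable {X A : Type*} {Y : Set ℝ} [MeasurableSpace X] [MeasurableSpace A]

/-- The conditional mean of the outcome, `μ(Γ)(x, a) = ∫ y Γ(dy | x, a)`. -/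
noncomputable def ProblemInstance.mean (I : ProblemInstance X A Y) (x : X) (a : A) : ℝ :=
  ∫ y, (y : ℝ) ∂(I.out (x, a))

/-- The conditional variance of the outcome, `σ²(x, a)`. -/
noncomputable def ProblemInstance.condVar (I : ProblemInstance X A Y) (x : X) (a : A) : ℝ :=
  ∫ y, ((y : ℝ) - I.mean x a) ^ 2 ∂(I.out (x, a))

/-- The inner product `⟨g(x, ·), μ(Γ)(x, ·)⟩` in `L²(lam)`. -/
noncomputable def ProblemInstance.actionValue (lam : Measure A) (g : X → A → ℝ)
    (I : ProblemInstance X A Y) (x : X) : ℝ :=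
  ∫ a, g x a * I.mean x a ∂lam

/-- The off-policy value `τ(I) = E_{x ∼ Ξ} ⟨g(x, ·), μ(Γ)(x, ·)⟩`. -/
noncomputable def ProblemInstance.value (lam : Measure A) (g : X → A → ℝ)
    (I : ProblemInstance X A Y) : ℝ :=
  ∫ x, I.actionValue lam g x ∂I.ctx

/-- All the integrals in the definition of the off-policy value `τ(I)` converge. -/
def ProblemInstance.ValueDefined (lam : Measure A) (g : X → A → ℝ)
    (I : ProblemInstance X A Y) : Prop :=
  (∀ x a, Integrable (fun y : Y => (y : ℝ)) (I.out (x, a))) ∧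
  (∀ᵐ x ∂I.ctx, Integrable (fun a => g x a * I.mean x a) lam) ∧
  Integrable (I.actionValue lam g) I.ctx

/-- The centred action value `h(x) = ⟨g(x, ·), μ(x, ·)⟩ - τ(I)`. -/
noncomputable def ProblemInstance.centredValue (lam : Measure A) (g : X → A → ℝ)
    (I : ProblemInstance X A Y) (x : X) : ℝ :=
  I.actionValue lam g x - I.value lam g

/-- Behaviour policies for `n` rounds (indexed from `0`): the policy of a round sees
the observations of all earlier rounds and the current context. -/
abbrev Behaviour (X : Type*) {A : Type*} (Y : Set ℝ) [MeasurableSpace X] [MeasurableSpace A]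
    (lam : Measure A) (n : ℕ) : Type _ :=
  (i : Fin n) → Policy ((Fin i → Obs X A Y) × X) lam

variable {lam : Measure A} {n : ℕ}

/-- Joint law of (past observations, context, action) in round `i`,
when the past observations have law `P`. -/
noncomputable def roundLaw (B : Behaviour X Y lam n) (I : ProblemInstance X A Y) (i : Fin n)
    (P : Measure (Fin i → Obs X A Y)) : Measure (((Fin i → Obs X A Y) × X) × A) :=
  (P.prod I.ctx) ⊗ₘ (B i).kernel

/-- The law of the first `k` observations `(X_j, A_j, Y_j)`, on `(X × A × Y)^k`: in each round an
independent context is drawn from `Ξ`, the action from the behaviour policy given the past and the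
context, and the outcome from `Γ` given the context and the action. -/
noncomputable def trajLaw (B : Behaviour X Y lam n) (I : ProblemInstance X A Y) :
    (k : ℕ) → k ≤ n → Measure (Fin k → Obs X A Y)
  | 0, _ => Measure.dirac Fin.elim0
  | k + 1, hk =>
    ((roundLaw B I ⟨k, hk⟩ (trajLaw B I k (Nat.le_of_succ_le hk))) ⊗ₘ
        (I.out.comap (fun p : ((Fin k → Obs X A Y) × X) × A => (p.1.2, p.2)) (by fun_prop))).map
      (fun q => Fin.snoc (α := fun _ => Obs X A Y) q.1.1.1 (q.1.1.2, q.1.2, q.2))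

/-- The law of (past observations, context, action) in round `i` under the instance `I`. -/
noncomputable def actionLaw (B : Behaviour X Y lam n) (I : ProblemInstance X A Y) (i : Fin n) :
    Measure (((Fin i → Obs X A Y) × X) × A) :=
  roundLaw B I i (trajLaw B I i i.2.le)

/-- The squared weighted norm
`‖φ‖²_(n) = (1/n) ∑ᵢ E_I [g²(X_i, A_i) φ²(X_i, A_i) / π_i²(X_i, O_{i-1}; A_i)]`. -/
noncomputable def weightedNormSq (B : Behaviour X Y lam n) (g : X → A → ℝ)
    (I : ProblemInstance X A Y) (φ : X → A → ℝ) : ℝ≥0∞ :=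
  (n : ℝ≥0∞)⁻¹ * ∑ i : Fin n, ∫⁻ p,
    ENNReal.ofReal (g p.1.2 p.2 ^ 2 * φ p.1.2 p.2 ^ 2 / (B i).density p.1 p.2 ^ 2)
      ∂(actionLaw B I i)

/-- The conditional standard deviation `σ`. -/
noncomputable def ProblemInstance.condSd (I : ProblemInstance X A Y) (x : X) (a : A) : ℝ :=
  √(I.condVar x a)

/-- The oracle variance `v² = Var_{x ∼ Ξ} ⟨g(x, ·), μ(x, ·)⟩ + ‖σ‖²_(n)`. -/
noncomputable def oracleVariance (B : Behaviour X Y lam n) (g : X → A → ℝ)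
    (I : ProblemInstance X A Y) : ℝ≥0∞ :=
  evariance (I.actionValue lam g) I.ctx + weightedNormSq B g I I.condSd

/-- The `(2, 4)`-moment ratio `√E[h⁴] / E[h²]`. -/
noncomputable def momentRatio {Ω : Type*} [MeasurableSpace Ω] (P : Measure Ω) (h : Ω → ℝ) :
    ℝ≥0∞ :=
  (∫⁻ ω, ENNReal.ofReal (h ω ^ 4) ∂P) ^ (1 / 2 : ℝ) / ∫⁻ ω, ENNReal.ofReal (h ω ^ 2) ∂P

/-- The local class `C_δ(I₀)`: instances (with a well-defined off-policy value) whose context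
distribution is within Kullback-Leibler divergence `1 / n` of that of `I₀` and whose outcome
kernel has conditional means within `δ` of those of `I₀`. -/
def localClass (lam : Measure A) (g : X → A → ℝ) (n : ℕ) (δ : X → A → ℝ)
    (I₀ : ProblemInstance X A Y) : Set (ProblemInstance X A Y) :=
  {I | InformationTheory.klDiv I.ctx I₀.ctx ≤ (n : ℝ≥0∞)⁻¹ ∧
    (∀ x a, |I.mean x a - I₀.mean x a| ≤ δ x a) ∧
    I.ValueDefined lam g}

/-- The local minimax mean squared error over a class of instances, for estimators based on
the `n` observations. -/
noncomputable def minimaxRisk (B : Behaviour X Y lam n) (g : X → A → ℝ)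
    (C : Set (ProblemInstance X A Y)) : ℝ≥0∞ :=
  ⨅ est : {t : (Fin n → Obs X A Y) → ℝ // Measurable t}, ⨆ I ∈ C,
    ∫⁻ o, ENNReal.ofReal ((est.1 o - I.value lam g) ^ 2) ∂(trajLaw B I n le_rfl)

end

end OffPolicy

/-! The two terms of the oracle variance come from two separate Le Cam arguments inside the local
class. Half of the minimax risk is then charged to each.

Contexts (`context_lower_bound`). Tilt `Ξ*` along the positive part of `±h`, with strength `1/√n`.
The chi-square divergence is at most `1/n`, hence so is the KL divergence. Contexts are drawn
independently of the past, so the likelihood ratio of `n` rounds has second moment at most `(1 +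
1/n)^n < 3`, whatever the policies. No estimator separates the two instances well, yet the value
moves by at least a quarter of the standard deviation of `h` times `1/√n`.

Outcomes (`outcome_lower_bound`). Since `Y` is unbounded, a tiny mass on a very distant atom shifts
each conditional mean by any amount `s ≤ δ` (`exists_shifted_instance`). With mass of order `1/n`
the new data law still dominates half of the old one (`pow_mul_lintegral_trajLaw_le`), so the shift
is practically invisible. Restricted to one sign of `g`, the shift moves the value without
cancellation, by at least `T/2` with `T = ∫∫ |g| s` (`abs_shift_lower_bound`). Taking for `s` the
average over `i` of the shifts allowed by the size condition gives `T ≥ ‖σ‖_(n) / (K √n)`, where `K`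
pays for replacing the adaptive densities by the reference ones. -/

namespace OffPolicy

/-- The likelihood ratio of `k` observations when the context distribution has density `f`. -/
noncomputable def ctxLikelihood {X A : Type*} {Y : Set ℝ} (f : X → ℝ≥0∞) {k : ℕ}
    (o : Fin k → Obs X A Y) : ℝ≥0∞ :=
  ∏ j, f (o j).1

theorem ctxLikelihood_snoc {X A : Type*} {Y : Set ℝ} (f : X → ℝ≥0∞) {k : ℕ}
    (o : Fin k → Obs X A Y) (z : Obs X A Y) :
    ctxLikelihood f (Fin.snoc (α := fun _ => Obs X A Y) o z) = ctxLikelihood f o * f z.1 := by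
  simp [ctxLikelihood, Fin.prod_univ_castSucc]

/-! ### Law of the trajectory: iterated integrals, domination and change of context distribution. -/

section Trajectory

variable {X A : Type*} {Y : Set ℝ} [MeasurableSpace X] [MeasurableSpace A]
  {lam : Measure A} {n : ℕ}

instance (I : ProblemInstance X A Y) : IsProbabilityMeasure I.ctx := I.isProb

instance (I : ProblemInstance X A Y) : IsMarkovKernel I.out := I.isMarkov

instance {H : Type*} [MeasurableSpace H] (P : Policy H lam) : IsMarkovKernel P.kernel :=
  P.isMarkov

instance isProbabilityMeasure_roundLaw (B : Behaviour X Y lam n) (I : ProblemInstance X A Y)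
    (i : Fin n) (P : Measure (Fin i → Obs X A Y)) [IsProbabilityMeasure P] :
    IsProbabilityMeasure (roundLaw B I i P) := by
  unfold roundLaw; infer_instance

theorem measurable_snoc_obs (k : ℕ) :
    Measurable (fun p : (Fin k → Obs X A Y) × Obs X A Y =>
      (Fin.snoc (α := fun _ => Obs X A Y) p.1 p.2 : Fin (k + 1) → Obs X A Y)) := by
  refine measurable_pi_iff.2 fun j => ?_
  refine Fin.lastCases ?_ (fun j => ?_) j
  · simp only [Fin.snoc_last]
    exact measurable_snd
  · simp only [Fin.snoc_castSucc]
    exact (measurable_pi_apply j).comp measurable_fst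

theorem measurable_appendRound (k : ℕ) :
    Measurable (fun q : (((Fin k → Obs X A Y) × X) × A) × Y =>
      (Fin.snoc (α := fun _ => Obs X A Y) q.1.1.1 (q.1.1.2, q.1.2, q.2) :
        Fin (k + 1) → Obs X A Y)) :=
  (measurable_snoc_obs (Y := Y) k).comp
    (f := fun q : (((Fin k → Obs X A Y) × X) × A) × Y => (q.1.1.1, (q.1.1.2, q.1.2, q.2)))
    (by fun_prop)

instance isProbabilityMeasure_trajLaw (B : Behaviour X Y lam n) (I : ProblemInstance X A Y) :
    ∀ (k : ℕ) (hk : k ≤ n), IsProbabilityMeasure (trajLaw B I k hk)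
  | 0, _ => by unfold trajLaw; infer_instance
  | k + 1, hk => by
    have := isProbabilityMeasure_trajLaw B I k (Nat.le_of_succ_le hk)
    have h := isProbabilityMeasure_roundLaw B I ⟨k, hk⟩ (trajLaw B I k (Nat.le_of_succ_le hk))
    unfold trajLaw
    exact Measure.isProbabilityMeasure_map (measurable_appendRound k).aemeasurable

/-- The joint law of past observations, context and action in a round as an iterated integral. -/
theorem lintegral_roundLaw (B : Behaviour X Y lam n) (I : ProblemInstance X A Y) (i : Fin n)
    (P : Measure (Fin i → Obs X A Y)) [IsProbabilityMeasure P]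
    {F : ((Fin i → Obs X A Y) × X) × A → ℝ≥0∞} (hF : Measurable F) :
    ∫⁻ p, F p ∂(roundLaw B I i P)
      = ∫⁻ o, ∫⁻ x, ∫⁻ a, F ((o, x), a) ∂((B i).kernel (o, x)) ∂I.ctx ∂P := by
  unfold roundLaw
  rw [Measure.lintegral_compProd hF, lintegral_prod]
  exact (Measurable.lintegral_kernel_prod_right' hF).aemeasurable

theorem measurable_lintegral_out_snoc (I : ProblemInstance X A Y)
    {k : ℕ} {F : (Fin (k + 1) → Obs X A Y) → ℝ≥0∞} (hF : Measurable F) :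
    Measurable fun p : ((Fin k → Obs X A Y) × X) × A =>
      ∫⁻ y, F (Fin.snoc (α := fun _ => Obs X A Y) p.1.1 (p.1.2, p.2, y)) ∂(I.out (p.1.2, p.2)) :=
  Measurable.lintegral_kernel_prod_right'
    (κ := I.out.comap (fun p : ((Fin k → Obs X A Y) × X) × A => (p.1.2, p.2)) (by fun_prop))
    (hF.comp (measurable_appendRound (X := X) (A := A) (Y := Y) k))

/-- One step of the data generating process as an iterated integral. -/
theorem lintegral_trajLaw_succ (B : Behaviour X Y lam n) (I : ProblemInstance X A Y)
    (k : ℕ) (hk : k + 1 ≤ n) {F : (Fin (k + 1) → Obs X A Y) → ℝ≥0∞} (hF : Measurable F) :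
    ∫⁻ o, F o ∂(trajLaw B I (k + 1) hk)
      = ∫⁻ o, ∫⁻ x, ∫⁻ a, ∫⁻ y,
          F (Fin.snoc (α := fun _ => Obs X A Y) o (x, a, y)) ∂(I.out (x, a))
          ∂((B ⟨k, hk⟩).kernel (o, x)) ∂I.ctx ∂(trajLaw B I k (Nat.le_of_succ_le hk)) := by
  have h := isProbabilityMeasure_roundLaw B I ⟨k, hk⟩ (trajLaw B I k (Nat.le_of_succ_le hk))
  rw [trajLaw, lintegral_map hF (measurable_appendRound k)]
  exact (Measure.lintegral_compProd (hF.comp (measurable_appendRound k))).trans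
    (lintegral_roundLaw B I ⟨k, hk⟩ _ (measurable_lintegral_out_snoc I hF))

theorem measurable_lintegral_snoc (B : Behaviour X Y lam n) (I : ProblemInstance X A Y)
    (k : ℕ) (hk : k < n) {F : (Fin (k + 1) → Obs X A Y) → ℝ≥0∞} (hF : Measurable F) :
    Measurable fun p : (Fin k → Obs X A Y) × X => ∫⁻ a, ∫⁻ y,
          F (Fin.snoc (α := fun _ => Obs X A Y) p.1 (p.2, a, y)) ∂(I.out (p.2, a))
          ∂((B ⟨k, hk⟩).kernel p) := by
  exact Measurable.lintegral_kernel_prod_right' (κ := (B ⟨k, hk⟩).kernel)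
    (measurable_lintegral_out_snoc I hF)

/-- If the outcome kernel dominates `c` times another one (with the same contexts), then the law of
`k` observations dominates `c ^ k` times the other one. -/
theorem pow_mul_lintegral_trajLaw_le (B : Behaviour X Y lam n) (I J : ProblemInstance X A Y)
    (hctx : J.ctx = I.ctx) {c : ℝ≥0∞} (hout : ∀ p, c • I.out p ≤ J.out p) :
    ∀ (k : ℕ) (hk : k ≤ n) {F : (Fin k → Obs X A Y) → ℝ≥0∞}, Measurable F →
      c ^ k * ∫⁻ o, F o ∂(trajLaw B I k hk) ≤ ∫⁻ o, F o ∂(trajLaw B J k hk)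
  | 0, hk, F, hF => by simp [trajLaw]
  | k + 1, hk, F, hF => by
    have hM := measurable_lintegral_snoc B I k hk hF
    have hM' := measurable_lintegral_out_snoc I hF
    -- The induction hypothesis is applied to `c` times the integrated last round: the extra `c`
    -- passes through contexts and actions, common to both laws, and is absorbed by the outcome
    -- kernel.
    have ih := pow_mul_lintegral_trajLaw_le B I J hctx hout k (Nat.le_of_succ_le hk)
      ((hM.lintegral_prod_right' (ν := I.ctx)).const_mul c)
    rw [lintegral_trajLaw_succ B I k hk hF, lintegral_trajLaw_succ B J k hk hF, pow_succ, mul_assoc,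
      ← lintegral_const_mul _ (hM.lintegral_prod_right' (ν := I.ctx))]
    refine ih.trans (lintegral_mono fun o => ?_)
    rw [hctx]
    refine (lintegral_const_mul _ (hM.comp (measurable_prodMk_left (x := o)))).ge.trans ?_
    refine lintegral_mono fun x => ?_
    refine (lintegral_const_mul _ (hM'.comp (measurable_prodMk_left (x := (o, x))))).ge.trans ?_
    refine lintegral_mono fun a => ?_
    have := lintegral_mono' (hout (x, a))
      (le_refl fun y => F (Fin.snoc (α := fun _ => Obs X A Y) o (x, a, y)))
    rwa [lintegral_smul_measure] at this

theorem measurable_ctxLikelihood {f : X → ℝ≥0∞} (hf : Measurable f) (k : ℕ) :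
    Measurable (ctxLikelihood (X := X) (A := A) (Y := Y) f (k := k)) :=
  Finset.measurable_prod _ fun j _ => hf.comp (measurable_fst.comp (measurable_pi_apply j))

/-- Policies and outcome kernel are shared, so they cancel from the likelihood ratio and only the
context densities remain, one factor per round. -/
theorem lintegral_trajLaw_withDensity (B : Behaviour X Y lam n) (I J : ProblemInstance X A Y)
    {f : X → ℝ≥0∞} (hf : Measurable f) (hctx : J.ctx = I.ctx.withDensity f)
    (hout : J.out = I.out) :
    ∀ (k : ℕ) (hk : k ≤ n) {F : (Fin k → Obs X A Y) → ℝ≥0∞}, Measurable F →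
      ∫⁻ o, F o ∂(trajLaw B J k hk) = ∫⁻ o, ctxLikelihood f o * F o ∂(trajLaw B I k hk)
  | 0, hk, F, hF => by
    have : ∀ o : Fin 0 → Obs X A Y, ctxLikelihood f o * F o = F o := fun o => by
      simp [ctxLikelihood]
    simp [trajLaw, this]
  | k + 1, hk, F, hF => by
    have hM := measurable_lintegral_snoc B I k hk hF
    have hG := hF.comp (measurable_appendRound (X := X) (A := A) (Y := Y) k)
    have hM' := measurable_lintegral_out_snoc I hF
    rw [lintegral_trajLaw_succ B I k hk (F := fun o => ctxLikelihood f o * F o)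
        ((measurable_ctxLikelihood hf _).mul hF),
      lintegral_trajLaw_succ B J k hk hF, hctx, hout]
    have h1 : Measurable fun o => ∫⁻ x, f x * ∫⁻ a, ∫⁻ y,
          F (Fin.snoc (α := fun _ => Obs X A Y) o (x, a, y)) ∂(I.out (x, a))
          ∂((B ⟨k, hk⟩).kernel (o, x)) ∂I.ctx :=
      ((hf.comp measurable_snd).mul hM).lintegral_prod_right' (ν := I.ctx)
    have h2 : ∀ o : Fin k → Obs X A Y, ∫⁻ x, ∫⁻ a, ∫⁻ y,
          F (Fin.snoc (α := fun _ => Obs X A Y) o (x, a, y)) ∂(I.out (x, a))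
          ∂((B ⟨k, hk⟩).kernel (o, x)) ∂(I.ctx.withDensity f) = ∫⁻ x, f x * ∫⁻ a, ∫⁻ y,
          F (Fin.snoc (α := fun _ => Obs X A Y) o (x, a, y)) ∂(I.out (x, a))
          ∂((B ⟨k, hk⟩).kernel (o, x)) ∂I.ctx := fun o =>
      lintegral_withDensity_eq_lintegral_mul _ hf (hM.comp (measurable_prodMk_left (x := o)))
    simp_rw [h2]
    rw [lintegral_trajLaw_withDensity B I J hf hctx hout k _ h1]
    refine lintegral_congr fun o => ?_
    refine (lintegral_const_mul _
      (hf.mul (hM.comp (measurable_prodMk_left (x := o))))).symm.trans ?_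
    refine lintegral_congr fun x => ?_
    rw [Pi.mul_apply, ← mul_assoc]
    simp only [ctxLikelihood_snoc]
    refine (lintegral_const_mul _
      (hM'.comp (measurable_prodMk_left (x := (o, x))))).symm.trans ?_
    refine lintegral_congr fun a => ?_
    exact (lintegral_const_mul _ (hG.comp (measurable_prodMk_left (x := ((o, x), a))))).symm

/-- Each context is independent of the past, even under adaptive policies, so the product integrates
factor by factor. Applied to a density and to its square, this gives the mean and the second moment
of the likelihood ratio. -/
theorem lintegral_ctxLikelihood (B : Behaviour X Y lam n) (I : ProblemInstance X A Y)
    {f : X → ℝ≥0∞} (hf : Measurable f) :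
    ∀ (k : ℕ) (hk : k ≤ n),
      ∫⁻ o, ctxLikelihood f o ∂(trajLaw B I k hk) = (∫⁻ x, f x ∂I.ctx) ^ k
  | 0, hk => by simp [ctxLikelihood]
  | k + 1, hk => by
    rw [lintegral_trajLaw_succ B I k hk (measurable_ctxLikelihood hf _)]
    simp only [ctxLikelihood_snoc, lintegral_const, measure_univ, mul_one]
    simp_rw [lintegral_const_mul _ hf]
    rw [lintegral_mul_const _ (measurable_ctxLikelihood hf _),
      lintegral_ctxLikelihood B I hf k _, pow_succ]

end Trajectory

end OffPolicy

/-! ### Lower bound from the unknown context distribution. -/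

namespace OffPolicy

section ContextPerturbation

variable {X A : Type*} {Y : Set ℝ} [MeasurableSpace X] [MeasurableSpace A]
  {lam : Measure A} {n : ℕ}

/-- Le Cam's reduction: the minimax risk is at least half the total risk at two instances. -/
theorem le_minimaxRisk_of_two_points (B : Behaviour X Y lam n) (g : X → A → ℝ)
    {C : Set (ProblemInstance X A Y)} {I J : ProblemInstance X A Y} (hI : I ∈ C) (hJ : J ∈ C)
    {b : ℝ≥0∞}
    (hb : ∀ t : (Fin n → Obs X A Y) → ℝ, Measurable t →
      2 * b ≤ ∫⁻ o, ENNReal.ofReal ((t o - I.value lam g) ^ 2) ∂(trajLaw B I n le_rfl) +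
        ∫⁻ o, ENNReal.ofReal ((t o - J.value lam g) ^ 2) ∂(trajLaw B J n le_rfl)) :
    b ≤ minimaxRisk B g C := by
  refine le_iInf fun t => ?_
  have h := (hb t.1 t.2).trans (add_le_add
    (le_iSup₂ (f := fun I (_ : I ∈ C) =>
      ∫⁻ o, ENNReal.ofReal ((t.1 o - I.value lam g) ^ 2) ∂(trajLaw B I n le_rfl)) I hI)
    (le_iSup₂ (f := fun I (_ : I ∈ C) =>
      ∫⁻ o, ENNReal.ofReal ((t.1 o - I.value lam g) ^ 2) ∂(trajLaw B I n le_rfl)) J hJ))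
  rw [← two_mul] at h
  exact (ENNReal.mul_le_mul_iff_right (by simp) (by simp)).1 h

/-- For fixed `b - a` the minimum of `a² + l b²` is `l (b - a)² / (1 + l)`, and `l / (1 + l) ≥ l / 2
- l² / 8`. With `l` a likelihood ratio, this bounds the sum of two risks through the first two
moments of `l` alone. -/
theorem sq_add_mul_sq_lower_bound {a b l : ℝ} (hl : 0 ≤ l) :
    l * ((b - a) ^ 2 / 2) ≤ a ^ 2 + l * b ^ 2 + l ^ 2 * ((b - a) ^ 2 / 8) := by
  have key : (1 + l) * (a ^ 2 + l * b ^ 2 + l ^ 2 * ((b - a) ^ 2 / 8) - l * ((b - a) ^ 2 / 2))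
      = (a * (1 + l) + l * (b - a)) ^ 2
        + (b - a) ^ 2 * (l * (((l - 3 / 2) ^ 2 + 7 / 4) / 8)) := by ring
  have h : 0 ≤ (1 + l) *
      (a ^ 2 + l * b ^ 2 + l ^ 2 * ((b - a) ^ 2 / 8) - l * ((b - a) ^ 2 / 2)) := by
    rw [key]; positivity
  have := nonneg_of_mul_nonneg_right h (by positivity)
  linarith

/-- The two-point bound when the context distributions have chi-square divergence at most `1/n`. -/
theorem two_point_context (B : Behaviour X Y lam n) (I J : ProblemInstance X A Y)
    {f : X → ℝ} (hf : Measurable f) (hf0 : ∀ x, 0 ≤ f x)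
    (hctx : J.ctx = I.ctx.withDensity (fun x => ENNReal.ofReal (f x))) (hout : J.out = I.out)
    (hn : 1 ≤ n)
    (hchi : ∫⁻ x, ENNReal.ofReal (f x ^ 2) ∂I.ctx ≤ ENNReal.ofReal (1 + 1 / n))
    {t : (Fin n → Obs X A Y) → ℝ} (ht : Measurable t) (u v : ℝ) :
    ENNReal.ofReal ((u - v) ^ 2 / 8) ≤
      ∫⁻ o, ENNReal.ofReal ((t o - u) ^ 2) ∂(trajLaw B I n le_rfl) +
        ∫⁻ o, ENNReal.ofReal ((t o - v) ^ 2) ∂(trajLaw B J n le_rfl) := by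
  set L : (Fin n → Obs X A Y) → ℝ := fun o => ∏ j, f (o j).1 with hL
  have hLm : Measurable L :=
    Finset.measurable_prod _ fun j _ => hf.comp (measurable_fst.comp (measurable_pi_apply j))
  have hL0 : ∀ o, 0 ≤ L o := fun o => Finset.prod_nonneg fun j _ => hf0 _
  have hLc : ∀ o, ctxLikelihood (fun x => ENNReal.ofReal (f x)) o = ENNReal.ofReal (L o) :=
    fun o => (ENNReal.ofReal_prod_of_nonneg fun j _ => hf0 _).symm
  have hLc2 : ∀ o, ctxLikelihood (fun x => ENNReal.ofReal (f x ^ 2)) o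
      = ENNReal.ofReal (L o ^ 2) := fun o => by
    rw [hL, ← Finset.prod_pow, ENNReal.ofReal_prod_of_nonneg fun j _ => sq_nonneg _]
    rfl
  have h1 : ∫⁻ o, ENNReal.ofReal (L o) ∂(trajLaw B I n le_rfl) = 1 := by
    have := lintegral_ctxLikelihood B I hf.ennreal_ofReal n le_rfl
    simp_rw [hLc] at this
    rw [this]
    have h := measure_univ (μ := J.ctx)
    rw [hctx, withDensity_apply _ MeasurableSet.univ, Measure.restrict_univ] at h
    rw [h, one_pow]
  -- Any bound below `4` would serve: integrating the pointwise inequality leaves `1/2 - 3/8 = 1/8`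
  -- of the squared separation.
  have h2 : ∫⁻ o, ENNReal.ofReal (L o ^ 2) ∂(trajLaw B I n le_rfl) ≤ 3 := by
    have := lintegral_ctxLikelihood B I (hf.pow_const 2).ennreal_ofReal n le_rfl
    simp_rw [hLc2] at this
    rw [this]
    have hn' : (n : ℝ) ≠ 0 := by positivity
    calc (∫⁻ x, ENNReal.ofReal (f x ^ 2) ∂I.ctx) ^ n
        ≤ ENNReal.ofReal (1 + 1 / n) ^ n := by gcongr
      _ = ENNReal.ofReal ((1 + 1 / n) ^ n) := (ENNReal.ofReal_pow (by positivity) _).symm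
      _ ≤ ENNReal.ofReal 3 := by
        refine ENNReal.ofReal_le_ofReal ?_
        calc (1 + 1 / (n : ℝ)) ^ n ≤ Real.exp (1 / n) ^ n := by
              gcongr; linarith [Real.add_one_le_exp (1 / (n : ℝ))]
          _ = Real.exp 1 := by rw [← Real.exp_nat_mul]; congr 1; field_simp
          _ ≤ 3 := by linarith [Real.exp_one_lt_d9]
      _ = 3 := by norm_num
  rw [lintegral_trajLaw_withDensity B I J hf.ennreal_ofReal hctx hout n le_rfl
    ((ht.sub_const v).pow_const 2).ennreal_ofReal]
  simp_rw [hLc]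
  have h3 : ENNReal.ofReal ((u - v) ^ 2 / 2) ≤
      ∫⁻ o, ENNReal.ofReal ((t o - u) ^ 2) ∂(trajLaw B I n le_rfl) +
      ∫⁻ o, ENNReal.ofReal (L o) * ENNReal.ofReal ((t o - v) ^ 2) ∂(trajLaw B I n le_rfl) +
      3 * ENNReal.ofReal ((u - v) ^ 2 / 8) := by
    calc ENNReal.ofReal ((u - v) ^ 2 / 2)
        = ∫⁻ o, ENNReal.ofReal (L o) * ENNReal.ofReal ((u - v) ^ 2 / 2)
            ∂(trajLaw B I n le_rfl) := by
          rw [lintegral_mul_const _ hLm.ennreal_ofReal, h1, one_mul]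
      _ ≤ ∫⁻ o, (ENNReal.ofReal ((t o - u) ^ 2) +
            ENNReal.ofReal (L o) * ENNReal.ofReal ((t o - v) ^ 2)) +
            ENNReal.ofReal (L o ^ 2) * ENNReal.ofReal ((u - v) ^ 2 / 8)
            ∂(trajLaw B I n le_rfl) := by
          refine lintegral_mono fun o => ?_
          have := sq_add_mul_sq_lower_bound (a := t o - u) (b := t o - v) (hL0 o)
          rw [show t o - v - (t o - u) = u - v by ring] at this
          rw [← ENNReal.ofReal_mul (hL0 o), ← ENNReal.ofReal_mul (hL0 o),
            ← ENNReal.ofReal_mul (sq_nonneg _), ← ENNReal.ofReal_add (sq_nonneg _)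
              (mul_nonneg (hL0 o) (sq_nonneg _)), ← ENNReal.ofReal_add
              (add_nonneg (sq_nonneg _) (mul_nonneg (hL0 o) (sq_nonneg _))) (by positivity)]
          exact ENNReal.ofReal_le_ofReal this
      _ = _ := by
          rw [lintegral_add_right _ ((hLm.pow_const 2).ennreal_ofReal.mul_const _),
            lintegral_add_left ((ht.sub_const u).pow_const 2).ennreal_ofReal,
            lintegral_mul_const _ (hLm.pow_const 2).ennreal_ofReal]
      _ ≤ _ := by gcongr
  have h4 : ENNReal.ofReal ((u - v) ^ 2 / 2)
      = ENNReal.ofReal ((u - v) ^ 2 / 8) + 3 * ENNReal.ofReal ((u - v) ^ 2 / 8) := by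
    rw [show (3 : ℝ≥0∞) = ENNReal.ofReal 3 by norm_num, ← ENNReal.ofReal_mul (by norm_num),
      ← ENNReal.ofReal_add (by positivity) (by positivity)]
    congr 1; ring
  rw [h4] at h3
  exact (ENNReal.add_le_add_iff_right (by finiteness)).1 h3

/-- Tilting a probability measure by the positive or the negative part of a centred square
integrable function. -/
theorem exists_tilt {Ω : Type*} [MeasurableSpace Ω] {ν : Measure Ω} [IsProbabilityMeasure ν]
    {h : Ω → ℝ} (hm : Measurable h) (h2 : MemLp h 2 ν) (h0 : ∫ x, h x ∂ν = 0)
    (hV : 0 < ∫ x, h x ^ 2 ∂ν) {ε : ℝ} (hε : 0 < ε) (hε1 : ε ≤ 1) :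
    ∃ f : Ω → ℝ, Measurable f ∧ (∀ x, 0 ≤ f x) ∧ MemLp f 2 ν ∧ ∫ x, f x ∂ν = 1 ∧
      ∫ x, f x ^ 2 ∂ν ≤ 1 + ε ^ 2 ∧
      ε / 4 * √(∫ x, h x ^ 2 ∂ν) ≤ |∫ x, f x * h x ∂ν| := by
  set V := ∫ x, h x ^ 2 ∂ν with hVdef
  have hsd : 0 < √V := Real.sqrt_pos.2 hV
  have hsd2 : √V ^ 2 = V := Real.sq_sqrt hV.le
  -- The positive and negative parts of `h` share its second moment, so one of them carries at least
  -- half. A one-sided tilt keeps the density nonnegative without `h` being bounded.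
  have hside : ∃ e : ℝ, e ^ 2 = 1 ∧ V / 2 ≤ ∫ x, max (e * h x) 0 ^ 2 ∂ν := by
    by_contra! hcon
    have a := hcon 1 (by norm_num)
    have b := hcon (-1) (by norm_num)
    have hp : MemLp (fun x => max (1 * h x) 0) 2 ν := (h2.const_mul 1).pos_part
    have hq : MemLp (fun x => max (-1 * h x) 0) 2 ν := (h2.const_mul (-1)).pos_part
    have : ∫ x, max (1 * h x) 0 ^ 2 ∂ν + ∫ x, max (-1 * h x) 0 ^ 2 ∂ν = V := by
      rw [← integral_add hp.integrable_sq hq.integrable_sq, hVdef]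
      refine integral_congr_ae (.of_forall fun x => ?_)
      rcases le_total 0 (h x) with hx | hx
      · simp [hx]
      · simp [hx]
    linarith
  obtain ⟨e, he, hq⟩ := hside
  set w : Ω → ℝ := fun x => max (e * h x) 0 / √V with hw
  have hwm : Measurable w := ((hm.const_mul e).max measurable_const).div_const _
  have hw0 : ∀ x, 0 ≤ w x := fun x => by positivity
  have hw2 : MemLp w 2 ν := by
    have := ((h2.const_mul e).pos_part).mul_const (√V)⁻¹
    simpa [hw, div_eq_mul_inv] using this
  have hwi : Integrable w ν := hw2.integrable one_le_two
  have hwsq : Integrable (fun x => w x ^ 2) ν := hw2.integrable_sq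
  set m := ∫ x, w x ∂ν with hmdef
  set q := ∫ x, w x ^ 2 ∂ν with hqdef
  have hq2 : 1 / 2 ≤ q := by
    have : q = (∫ x, max (e * h x) 0 ^ 2 ∂ν) / V := by
      rw [hqdef, ← integral_div]
      simp_rw [hw, div_pow, hsd2]
    rw [this, le_div_iff₀ hV]; linarith
  have hq1 : q ≤ 1 := by
    have : q ≤ ∫ x, h x ^ 2 / V ∂ν := by
      refine integral_mono hwsq (h2.integrable_sq.div_const _) fun x => ?_
      simp only [hw, div_pow, hsd2]
      refine div_le_div_of_nonneg_right ?_ hV.le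
      rcases le_total 0 (e * h x) with hx | hx
      · rw [max_eq_left hx, mul_pow, he, one_mul]
      · rw [max_eq_right hx, zero_pow two_ne_zero]; positivity
    rwa [integral_div, div_self hV.ne'] at this
  have hm0 : 0 ≤ m := integral_nonneg hw0
  have hm1 : m ≤ 1 := by
    have : m ≤ ∫ x, (w x ^ 2 + 1) / 2 ∂ν := by
      refine integral_mono hwi ((hwsq.add (integrable_const 1)).div_const 2) fun x => ?_
      have := sq_nonneg (w x - 1)
      simp only
      linarith
    rw [integral_div, integral_add hwsq (integrable_const 1)] at this
    simp only [integral_const, probReal_univ, smul_eq_mul, mul_one] at this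
    linarith
  have hZ : 0 < 1 + ε * m := by positivity
  -- On the support of `w`, `h` is a multiple of `w`; the correlation of the tilt with `h` is thus
  -- governed by `q = ∫ w² ≥ 1/2`.
  have hwh : ∀ x, w x * h x = e * √V * w x ^ 2 := fun x => by
    simp only [hw]
    rcases le_total 0 (e * h x) with hx | hx
    · rw [max_eq_left hx, div_pow, hsd2, mul_pow, he]
      field_simp
      rw [hsd2]
    · rw [max_eq_right hx]; simp
  refine ⟨fun x => (1 + ε * w x) / (1 + ε * m), ((hwm.const_mul ε).const_add 1).div_const _,
    fun x => div_nonneg (by have := hw0 x; positivity) hZ.le, ?_, ?_, ?_, ?_⟩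
  · have := ((memLp_const (1 : ℝ)).add (hw2.const_mul ε)).mul_const (1 + ε * m)⁻¹
    simpa [div_eq_mul_inv] using this
  · rw [integral_div, integral_add (integrable_const 1) (hwi.const_mul ε), integral_const_mul]
    simp only [integral_const, probReal_univ, smul_eq_mul, mul_one]
    exact div_self hZ.ne'
  -- The linear term `2 ε m` is absorbed by the normalisation `(1 + ε m)²`; only `ε² q ≤ ε²` is
  -- left.
  · have : ∫ x, ((1 + ε * w x) / (1 + ε * m)) ^ 2 ∂ν
        = (1 + 2 * ε * m + ε ^ 2 * q) / (1 + ε * m) ^ 2 := by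
      simp_rw [div_pow]
      rw [integral_div]
      congr 1
      have e1 : ∀ x, (1 + ε * w x) ^ 2 = (1 + 2 * ε * w x) + ε ^ 2 * w x ^ 2 := fun x => by ring
      simp_rw [e1]
      have hlin : Integrable (fun x => 1 + 2 * ε * w x) ν :=
        (integrable_const 1).add (hwi.const_mul _)
      rw [integral_add hlin (hwsq.const_mul _),
        integral_add (integrable_const 1) (hwi.const_mul _), integral_const_mul,
        integral_const_mul]
      simp [hmdef, hqdef]
    rw [this, div_le_iff₀ (by positivity)]
    have hx : 1 ≤ (1 + ε * m) ^ 2 := one_le_pow₀ (by have : 0 ≤ ε * m := by positivity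
                                                     linarith)
    have hy : ε ^ 2 * q ≤ ε ^ 2 * (1 + ε * m) ^ 2 := by gcongr; linarith
    have hz : 0 ≤ (ε * m) ^ 2 := sq_nonneg _
    linarith
  · have hwhi : Integrable (fun x => w x * h x) ν := by
      simp_rw [hwh]; exact hwsq.const_mul _
    have : ∫ x, (1 + ε * w x) / (1 + ε * m) * h x ∂ν = e * (ε * √V * q / (1 + ε * m)) := by
      have e1 : ∀ x, (1 + ε * w x) / (1 + ε * m) * h x
          = (h x + ε * (w x * h x)) / (1 + ε * m) := fun x => by ring
      simp_rw [e1]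
      rw [integral_div, integral_add (h2.integrable one_le_two) (hwhi.const_mul ε), h0,
        integral_const_mul]
      simp_rw [hwh]
      rw [integral_const_mul]
      ring
    have he' : |e| = 1 := by
      rw [← sq_abs] at he
      exact (pow_eq_one_iff_of_nonneg (abs_nonneg e) two_ne_zero).1 he
    rw [this, abs_mul, he', one_mul, abs_of_nonneg (by positivity), le_div_iff₀ hZ]
    -- The factor `1/4` is `q ≥ 1/2` divided by a normalisation of at most `2`.
    have hZ2 : 1 + ε * m ≤ 2 := by nlinarith
    calc ε / 4 * √V * (1 + ε * m) ≤ ε / 4 * √V * 2 := by gcongr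
      _ = ε * √V * (1 / 2) := by ring
      _ ≤ ε * √V * q := by gcongr

/-- Insert `log x ≤ x - 1` into `x log x + 1 - x`. -/
theorem klFun_le_sub_one_sq {x : ℝ} (hx : 0 ≤ x) : InformationTheory.klFun x ≤ (x - 1) ^ 2 := by
  rw [InformationTheory.klFun]
  rcases hx.eq_or_lt with rfl | hx
  · simp
  · nlinarith [Real.log_le_sub_one_of_pos hx]

/-- The Kullback-Leibler divergence is at most the chi-square divergence. -/
theorem klDiv_withDensity_le {Ω : Type*} [MeasurableSpace Ω] {ν : Measure Ω}
    [IsProbabilityMeasure ν] {f : Ω → ℝ} (hf : Measurable f) (hf0 : ∀ x, 0 ≤ f x)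
    (hf2 : MemLp f 2 ν) (hf1 : ∫ x, f x ∂ν = 1) :
    InformationTheory.klDiv (ν.withDensity fun x => ENNReal.ofReal (f x)) ν ≤
      ENNReal.ofReal (∫ x, f x ^ 2 ∂ν - 1) := by
  have hfi := hf2.integrable one_le_two
  have : IsFiniteMeasure (ν.withDensity fun x => ENNReal.ofReal (f x)) :=
    isFiniteMeasure_withDensity_ofReal hfi.2
  rw [InformationTheory.klDiv_eq_lintegral_klFun_of_ac (withDensity_absolutelyContinuous _ _)]
  calc _ ≤ ∫⁻ x, ENNReal.ofReal ((f x - 1) ^ 2) ∂ν := by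
        refine lintegral_mono_ae ?_
        filter_upwards [Measure.rnDeriv_withDensity ν hf.ennreal_ofReal] with x hx
        rw [hx, ENNReal.toReal_ofReal (hf0 x)]
        exact ENNReal.ofReal_le_ofReal (klFun_le_sub_one_sq (hf0 x))
    _ = ENNReal.ofReal (∫ x, (f x - 1) ^ 2 ∂ν) :=
        (ofReal_integral_eq_lintegral_ofReal (hf2.sub (memLp_const 1)).integrable_sq
          (.of_forall fun x => sq_nonneg _)).symm
    _ = ENNReal.ofReal (∫ x, f x ^ 2 ∂ν - 1) := by
        congr 1
        have e1 : ∀ x, (f x - 1) ^ 2 = f x ^ 2 - (2 * f x - 1) := fun x => by ring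
        simp_rw [e1]
        have hlin : Integrable (fun x => 2 * f x - 1) ν :=
          (hfi.const_mul 2).sub (integrable_const 1)
        rw [integral_sub hf2.integrable_sq hlin,
          integral_sub (hfi.const_mul 2) (integrable_const 1), integral_const_mul, hf1]
        norm_num

theorem measurable_mean (I : ProblemInstance X A Y) :
    Measurable fun p : X × A => I.mean p.1 p.2 :=
  (StronglyMeasurable.integral_kernel (κ := I.out)
    (f := fun y : Y => (y : ℝ)) measurable_subtype_coe.stronglyMeasurable).measurable

theorem measurable_actionValue [SFinite lam] {g : X → A → ℝ}
    (hg : Measurable (Function.uncurry g)) (I : ProblemInstance X A Y) :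
    Measurable (I.actionValue lam g) :=
  (StronglyMeasurable.integral_prod_right'
    (f := fun p : X × A => g p.1 p.2 * I.mean p.1 p.2)
    (hg.mul (measurable_mean I)).stronglyMeasurable).measurable

theorem mem_localClass_self {g : X → A → ℝ} {δ : X → A → ℝ} (hδ : ∀ x a, 0 ≤ δ x a)
    {I : ProblemInstance X A Y} (hI : I.ValueDefined lam g) : I ∈ localClass lam g n δ I := by
  refine ⟨?_, fun x a => by simpa using hδ x a, hI⟩
  rw [InformationTheory.klDiv_self]; exact zero_le

/-- The contribution of the unknown context distribution to the minimax risk. -/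
theorem context_lower_bound [SFinite lam] (hn : 1 ≤ n) {g : X → A → ℝ}
    (hg : Measurable (Function.uncurry g)) (B : Behaviour X Y lam n) (I : ProblemInstance X A Y)
    (hval : I.ValueDefined lam g) (hmem : MemLp (I.centredValue lam g) 2 I.ctx)
    {δ : X → A → ℝ} (hδ : ∀ x a, 0 ≤ δ x a) :
    ENNReal.ofReal (1 / 256) * (evariance (I.actionValue lam g) I.ctx / n) ≤
      minimaxRisk B g (localClass lam g n δ I) := by
  set h := I.centredValue lam g with hh
  have hhm : Measurable h := (measurable_actionValue hg I).sub_const _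
  have hn0 : (0 : ℝ) < n := by exact_mod_cast hn
  have hvar : evariance (I.actionValue lam g) I.ctx = ENNReal.ofReal (∫ x, h x ^ 2 ∂I.ctx) := by
    rw [evariance_eq_lintegral_ofReal, ofReal_integral_eq_lintegral_ofReal hmem.integrable_sq
      (.of_forall fun x => sq_nonneg _)]
    rfl
  have hV0 : 0 ≤ ∫ x, h x ^ 2 ∂I.ctx := integral_nonneg fun x => sq_nonneg _
  rcases hV0.eq_or_lt with hV | hV
  · rw [hvar, ← hV]; simp
  have h0 : ∫ x, h x ∂I.ctx = 0 := by
    rw [hh]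
    simp only [ProblemInstance.centredValue]
    rw [integral_sub hval.2.2 (integrable_const _)]
    simp [ProblemInstance.value]
  -- This makes the chi-square bound `ε²` equal to `1/n`, which serves both as the KL radius of the
  -- class and in the second moment of the `n`-round likelihood ratio.
  set ε : ℝ := 1 / √n with hε
  have hε2 : ε ^ 2 = 1 / n := by rw [hε, div_pow, Real.sq_sqrt hn0.le, one_pow]
  have hε0 : 0 < ε := by positivity
  have hε1 : ε ≤ 1 := by
    rw [hε, div_le_one (by positivity), Real.one_le_sqrt]
    exact_mod_cast hn
  obtain ⟨f, hfm, hf0, hf2, hf1, hfsq, hshift⟩ := exists_tilt hhm hmem h0 hV hε0 hε1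
  have hfi := hf2.integrable one_le_two
  let J : ProblemInstance X A Y :=
    { ctx := I.ctx.withDensity fun x => ENNReal.ofReal (f x)
      isProb := ⟨by
        rw [withDensity_apply _ MeasurableSet.univ, Measure.restrict_univ,
          ← ofReal_integral_eq_lintegral_ofReal hfi (.of_forall hf0), hf1, ENNReal.ofReal_one]⟩
      out := I.out
      isMarkov := I.isMarkov }
  have hfh : Integrable (fun x => f x * h x) I.ctx := hf2.integrable_mul hmem
  have hfav : ∀ x, (ENNReal.ofReal (f x)).toReal • I.actionValue lam g x
      = f x * h x + f x * I.value lam g := fun x => by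
    rw [ENNReal.toReal_ofReal (hf0 x), smul_eq_mul, hh, ProblemInstance.centredValue]; ring
  have hJval : J.ValueDefined lam g := by
    refine ⟨hval.1, (withDensity_absolutelyContinuous I.ctx _).ae_le hval.2.1, ?_⟩
    refine (integrable_withDensity_iff_integrable_smul' hfm.ennreal_ofReal
      (.of_forall fun x => ENNReal.ofReal_lt_top)).2 ?_
    exact (hfh.add (hfi.mul_const (I.value lam g))).congr (.of_forall fun x => (hfav x).symm)
  have hJmem : J ∈ localClass lam g n δ I := by
    refine ⟨?_, fun x a => ?_, hJval⟩
    · refine (klDiv_withDensity_le hfm hf0 hf2 hf1).trans ?_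
      rw [← ENNReal.ofReal_natCast, ← ENNReal.ofReal_inv_of_pos hn0]
      refine ENNReal.ofReal_le_ofReal ?_
      rw [← one_div, ← hε2]; linarith
    · have : J.mean x a = I.mean x a := rfl
      rw [this]; simpa using hδ x a
  have hJv : J.value lam g - I.value lam g = ∫ x, f x * h x ∂I.ctx := by
    have : J.value lam g = ∫ x, f x * h x + f x * I.value lam g ∂I.ctx := by
      refine (integral_withDensity_eq_integral_toReal_smul hfm.ennreal_ofReal
        (.of_forall fun x => ENNReal.ofReal_lt_top) _).trans ?_
      exact integral_congr_ae (.of_forall hfav)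
    rw [this, integral_add hfh (hfi.mul_const _), integral_mul_const, hf1]; ring
  have hchi : ∫⁻ x, ENNReal.ofReal (f x ^ 2) ∂I.ctx ≤ ENNReal.ofReal (1 + 1 / n) := by
    rw [← ofReal_integral_eq_lintegral_ofReal hf2.integrable_sq
      (.of_forall fun x => sq_nonneg _), ← hε2]
    exact ENNReal.ofReal_le_ofReal hfsq
  refine le_minimaxRisk_of_two_points B g (mem_localClass_self hδ hval) hJmem fun t ht => ?_
  refine le_trans ?_ (two_point_context B I J hfm hf0 rfl rfl hn hchi ht _ _)
  rw [hvar, ← ENNReal.ofReal_natCast, ← ENNReal.ofReal_div_of_pos hn0,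
    ← ENNReal.ofReal_mul (by norm_num), show (2 : ℝ≥0∞) = ENNReal.ofReal 2 by norm_num,
    ← ENNReal.ofReal_mul (by norm_num)]
  refine ENNReal.ofReal_le_ofReal ?_
  -- The squared shift is at least `V / (16 n)`. The two-point bound costs a factor `8` and
  -- averaging over two instances a factor `2`, whence `256`.
  rw [← hJv] at hshift
  have := pow_le_pow_left₀ (by positivity) hshift 2
  rw [sq_abs, mul_pow, Real.sq_sqrt hV0, div_pow, hε2] at this
  rw [← neg_sub, neg_sq]
  calc _ = (1 / (n : ℝ) / 4 ^ 2 * ∫ x, h x ^ 2 ∂I.ctx) / 8 := by ring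
    _ ≤ _ := by gcongr

end ContextPerturbation

end OffPolicy

/-! ### Lower bound from invisible shifts of the outcome means. -/

namespace OffPolicy

section OutcomePerturbation

variable {X A : Type*} {Y : Set ℝ} [MeasurableSpace X] [MeasurableSpace A]
  {lam : Measure A} {n : ℕ}

theorem exists_sign_forall_nat_le {Y : Set ℝ} (hY : ¬ Bornology.IsBounded Y) :
    ∃ e : ℝ, e ^ 2 = 1 ∧ ∀ k : ℕ, ∃ y : Y, (k : ℝ) ≤ e * y := by
  rw [isBounded_iff_bddBelow_bddAbove, not_and_or, not_bddBelow_iff, not_bddAbove_iff] at hY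
  rcases hY with h | h
  · refine ⟨-1, by norm_num, fun k => ?_⟩
    obtain ⟨y, hy, hk⟩ := h (-k)
    exact ⟨⟨y, hy⟩, by simp only; linarith⟩
  · refine ⟨1, by norm_num, fun k => ?_⟩
    obtain ⟨y, hy, hk⟩ := h k
    exact ⟨⟨y, hy⟩, by simp only; linarith⟩

/-- In an unbounded outcome space, contaminating the outcomes with a distant atom shifts the
conditional means by any prescribed amount, at an arbitrarily small change of the outcome law. -/
theorem exists_shifted_instance (I : ProblemInstance X A Y)
    (hI : ∀ x a, Integrable (fun y : Y => (y : ℝ)) (I.out (x, a)))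
    {e : ℝ} (he : e ^ 2 = 1) (hY : ∀ k : ℕ, ∃ y : Y, (k : ℝ) ≤ e * y)
    {s : X → A → ℝ} (hs : Measurable (Function.uncurry s)) (hs0 : ∀ x a, 0 ≤ s x a)
    {η : ℝ} (hη : 0 < η) (hη1 : η ≤ 1) :
    ∃ J : ProblemInstance X A Y, J.ctx = I.ctx ∧
      (∀ x a, Integrable (fun y : Y => (y : ℝ)) (J.out (x, a))) ∧
      (∀ x a, J.mean x a = I.mean x a + e * s x a) ∧
      ∀ p, ENNReal.ofReal (1 - η) • I.out p ≤ J.out p := by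
  choose far hfar using hY
  have hμ := measurable_mean I
  have hs' : Measurable fun p : X × A => s p.1 p.2 := hs
  -- The atom depends on `p` only through a natural number, which makes its choice measurable. Its
  -- distance from the mean is at least `s / η + 1`: the first term keeps the weight below `η`, the
  -- `1` keeps the gap positive where `s = 0`.
  set yy : X × A → Y := fun p => far ⌈e * I.mean p.1 p.2 + s p.1 p.2 / η + 1⌉₊ with hyy
  have hyym : Measurable yy := by
    have hceil : Measurable fun p : X × A => ⌈e * I.mean p.1 p.2 + s p.1 p.2 / η + 1⌉₊ :=
      Nat.measurable_ceil.comp (((hμ.const_mul e).add (hs'.div_const η)).add_const 1)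
    exact (measurable_from_nat (f := far)).comp hceil
  have hgap : ∀ p, s p.1 p.2 / η + 1 ≤ e * ((yy p : ℝ) - I.mean p.1 p.2) := fun p => by
    have h1 := Nat.le_ceil (e * I.mean p.1 p.2 + s p.1 p.2 / η + 1)
    have h2 := hfar ⌈e * I.mean p.1 p.2 + s p.1 p.2 / η + 1⌉₊
    rw [mul_sub]
    linarith
  have hsη : ∀ p : X × A, 0 ≤ s p.1 p.2 / η := fun p => div_nonneg (hs0 _ _) hη.le
  have hpos : ∀ p, 0 < e * ((yy p : ℝ) - I.mean p.1 p.2) := fun p => by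
    linarith [hgap p, hsη p]
  -- The weight for which `w` times the gap is exactly `s`.
  set w : X × A → ℝ := fun p => s p.1 p.2 / (e * ((yy p : ℝ) - I.mean p.1 p.2)) with hw
  have hwm : Measurable w :=
    hs'.div (((measurable_subtype_coe.comp hyym).sub hμ).const_mul e)
  have hw0 : ∀ p, 0 ≤ w p := fun p => div_nonneg (hs0 _ _) (hpos p).le
  have hwη : ∀ p, w p ≤ η := fun p => by
    rw [hw, div_le_iff₀ (hpos p), ← div_le_iff₀' hη]
    linarith [hgap p]
  let κ : Kernel (X × A) Y :=
    { toFun := fun p => ENNReal.ofReal (1 - w p) • I.out p +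
        ENNReal.ofReal (w p) • Measure.dirac (yy p)
      measurable' := by
        refine Measure.measurable_of_measurable_coe _ fun t ht => ?_
        simp only [Measure.coe_add, Measure.coe_smul, Pi.add_apply, Pi.smul_apply, smul_eq_mul]
        exact ((hwm.const_sub 1).ennreal_ofReal.mul (I.out.measurable_coe ht)).add
          (hwm.ennreal_ofReal.mul ((Measure.measurable_coe ht).comp
            (Measure.measurable_dirac.comp hyym))) }
  have hκ : ∀ p, κ p = ENNReal.ofReal (1 - w p) • I.out p +
        ENNReal.ofReal (w p) • Measure.dirac (yy p) := fun p => rfl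
  let J : ProblemInstance X A Y :=
    { ctx := I.ctx
      isProb := I.isProb
      out := κ
      isMarkov := ⟨fun p => ⟨by
        rw [hκ]
        simp only [Measure.coe_add, Measure.coe_smul, Pi.add_apply, Pi.smul_apply, smul_eq_mul,
          measure_univ, mul_one]
        rw [← ENNReal.ofReal_add (by linarith [hwη p]) (hw0 p)]
        simp⟩⟩ }
  have hint0 : ∀ p : X × A, Integrable (fun y : Y => (y : ℝ))
      (ENNReal.ofReal (1 - w p) • I.out p) :=
    fun p => (hI p.1 p.2).smul_measure ENNReal.ofReal_ne_top
  have hint1 : ∀ p : X × A, Integrable (fun y : Y => (y : ℝ))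
      (ENNReal.ofReal (w p) • Measure.dirac (yy p)) := fun p =>
    (integrable_dirac (by simp)).smul_measure ENNReal.ofReal_ne_top
  refine ⟨J, rfl, fun x a => (hint0 (x, a)).add_measure (hint1 (x, a)), fun x a => ?_,
    fun p => ?_⟩
  · have h1 : J.mean x a = ∫ y : Y, (y : ℝ) ∂(ENNReal.ofReal (1 - w (x, a)) • I.out (x, a) +
        ENNReal.ofReal (w (x, a)) • Measure.dirac (yy (x, a))) := rfl
    rw [h1, integral_add_measure (hint0 (x, a)) (hint1 (x, a)), integral_smul_measure,
      integral_smul_measure, integral_dirac, ENNReal.toReal_ofReal (by linarith [hwη (x, a)]),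
      ENNReal.toReal_ofReal (hw0 _), smul_eq_mul, smul_eq_mul]
    have h2 : w (x, a) * (e * ((yy (x, a) : ℝ) - I.mean x a)) = s x a :=
      div_mul_cancel₀ _ (hpos (x, a)).ne'
    change (1 - w (x, a)) * I.mean x a + w (x, a) * (yy (x, a) : ℝ) = _
    rw [← h2]
    linear_combination (-(w (x, a) * ((yy (x, a) : ℝ) - I.mean x a))) * he
  · change _ ≤ κ p
    rw [hκ]
    refine Measure.le_add_right ?_
    refine Measure.le_iff.2 fun t ht => ?_
    simp only [Measure.coe_smul, Pi.smul_apply, smul_eq_mul]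
    gcongr
    exact hwη p

/-- The two-point bound for a shift of the conditional means that keeps a fixed sign
relative to `g`. -/
theorem shift_lower_bound [SigmaFinite lam] {g : X → A → ℝ}
    (hg : Measurable (Function.uncurry g)) (B : Behaviour X Y lam n) (I : ProblemInstance X A Y)
    (hval : I.ValueDefined lam g) (hY : ¬ Bornology.IsBounded Y)
    {δ : X → A → ℝ} (hδ : ∀ x a, 0 ≤ δ x a)
    {s : X → A → ℝ} (hs : Measurable (Function.uncurry s)) (hs0 : ∀ x a, 0 ≤ s x a)
    (hsδ : ∀ x a, s x a ≤ δ x a) {σ : ℝ} (hσ : ∀ x a, g x a * s x a = σ * (|g x a| * s x a))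
    (hσ1 : σ ^ 2 = 1)
    (hT : ∫⁻ x, ∫⁻ a, ENNReal.ofReal (|g x a| * s x a) ∂lam ∂I.ctx ≠ ⊤) :
    ENNReal.ofReal
        ((∫⁻ x, ∫⁻ a, ENNReal.ofReal (|g x a| * s x a) ∂lam ∂I.ctx).toReal ^ 2 / 8) ≤
      minimaxRisk B g (localClass lam g n δ I) := by
  obtain ⟨e, he, hfar⟩ := exists_sign_forall_nat_le hY
  have habs : |e| = 1 := by
    rw [← sq_abs] at he
    exact (pow_eq_one_iff_of_nonneg (abs_nonneg e) two_ne_zero).1 he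
  -- By Bernoulli's inequality `(1 - η)^n ≥ 1/2`.
  set η : ℝ := 1 / (2 * (n + 1)) with hη
  have hη0 : 0 < η := by positivity
  have hη2 : η ≤ 1 / 2 := by
    rw [hη]
    gcongr
    have : (0 : ℝ) ≤ n := n.cast_nonneg
    linarith
  obtain ⟨J, hctx, hJint, hJmean, hJout⟩ :=
    exists_shifted_instance I hval.1 he hfar hs hs0 hη0 (by linarith)
  set T := ∫⁻ x, ∫⁻ a, ENNReal.ofReal (|g x a| * s x a) ∂lam ∂I.ctx with hTdef
  have hFm : Measurable fun p : X × A => |g p.1 p.2| * s p.1 p.2 :=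
    Measurable.mul (measurable_norm.comp hg) hs
  have hF0 : ∀ p : X × A, 0 ≤ |g p.1 p.2| * s p.1 p.2 := fun p =>
    mul_nonneg (abs_nonneg _) (hs0 _ _)
  have hTprod : ∫⁻ p, ENNReal.ofReal (|g p.1 p.2| * s p.1 p.2) ∂(I.ctx.prod lam) = T :=
    lintegral_prod _ hFm.ennreal_ofReal.aemeasurable
  have hFint : Integrable (fun p : X × A => |g p.1 p.2| * s p.1 p.2) (I.ctx.prod lam) := by
    refine ⟨hFm.aestronglyMeasurable, ?_⟩
    rw [hasFiniteIntegral_iff_ofReal (.of_forall hF0), hTprod]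
    exact hT.lt_top
  have hTint : ∫ x, ∫ a, |g x a| * s x a ∂lam ∂I.ctx = T.toReal := by
    rw [← hTprod, ← integral_eq_lintegral_of_nonneg_ae (.of_forall hF0)
      hFm.aestronglyMeasurable]
    exact (integral_prod _ hFint).symm
  have hJg : ∀ x a, g x a * J.mean x a
      = g x a * I.mean x a + (e * σ) * (|g x a| * s x a) := fun x a => by
    rw [hJmean]
    linear_combination e * hσ x a
  have hJav : J.actionValue lam g =ᵐ[I.ctx] fun x =>
      I.actionValue lam g x + (e * σ) * ∫ a, |g x a| * s x a ∂lam := by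
    filter_upwards [hval.2.1, hFint.prod_right_ae] with x h1 h2
    simp only [ProblemInstance.actionValue]
    simp_rw [hJg]
    rw [integral_add h1 (h2.const_mul _), integral_const_mul]
  have hinner : Integrable (fun x => ∫ a, |g x a| * s x a ∂lam) I.ctx := hFint.integral_prod_left
  have hJval : J.ValueDefined lam g := by
    refine ⟨hJint, ?_, ?_⟩
    · rw [hctx]
      filter_upwards [hval.2.1, hFint.prod_right_ae] with x h1 h2
      simp_rw [hJg]
      exact h1.add (h2.const_mul _)
    · rw [hctx]
      exact (hval.2.2.add (hinner.const_mul (e * σ))).congr hJav.symm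
  have hJmem : J ∈ localClass lam g n δ I := by
    refine ⟨?_, fun x a => ?_, hJval⟩
    · rw [hctx, InformationTheory.klDiv_self]; exact zero_le
    · rw [hJmean, add_sub_cancel_left, abs_mul, habs, one_mul, abs_of_nonneg (hs0 x a)]
      exact hsδ x a
  have hJv : J.value lam g = I.value lam g + (e * σ) * T.toReal := by
    rw [ProblemInstance.value, hctx, integral_congr_ae hJav,
      integral_add hval.2.2 (hinner.const_mul _), integral_const_mul, hTint]
    rfl
  refine le_minimaxRisk_of_two_points B g (mem_localClass_self hδ hval) hJmem fun t ht => ?_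
  have hhalf : (1 / 2 : ℝ) ≤ (1 - η) ^ n := by
    have h1 := one_add_mul_le_pow (a := -η) (by linarith) n
    have h2 : (n : ℝ) * η ≤ 1 / 2 := by
      rw [hη, mul_one_div, div_le_iff₀ (by positivity)]
      linarith
    rw [sub_eq_add_neg]
    linarith
  have hJm := ((ht.sub_const (J.value lam g)).pow_const 2).ennreal_ofReal
  have hdom : ENNReal.ofReal (1 / 2) *
      ∫⁻ o, ENNReal.ofReal ((t o - J.value lam g) ^ 2) ∂(trajLaw B I n le_rfl) ≤
      ∫⁻ o, ENNReal.ofReal ((t o - J.value lam g) ^ 2) ∂(trajLaw B J n le_rfl) := by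
    refine le_trans ?_ (pow_mul_lintegral_trajLaw_le B I J hctx hJout n le_rfl hJm)
    rw [← ENNReal.ofReal_pow (by linarith)]
    gcongr
  refine le_trans ?_ (add_le_add_right hdom _)
  rw [← lintegral_const_mul _ hJm, ← lintegral_add_right _ (hJm.const_mul _)]
  have hconst : 2 * ENNReal.ofReal (T.toReal ^ 2 / 8) =
      ∫⁻ _, ENNReal.ofReal (T.toReal ^ 2 / 4) ∂(trajLaw B I n le_rfl) := by
    rw [lintegral_const, measure_univ, mul_one, show (2 : ℝ≥0∞) = ENNReal.ofReal 2 by norm_num,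
      ← ENNReal.ofReal_mul (by norm_num)]
    congr 1; ring
  rw [hconst]
  refine lintegral_mono fun o => ?_
  rw [← ENNReal.ofReal_mul (by norm_num), ← ENNReal.ofReal_add (sq_nonneg _) (by positivity)]
  refine ENNReal.ofReal_le_ofReal ?_
  have hd : T.toReal ^ 2 = ((t o - I.value lam g) - (t o - J.value lam g)) ^ 2 := by
    rw [hJv]
    linear_combination (-(T.toReal ^ 2)) * σ ^ 2 * he - T.toReal ^ 2 * hσ1
  -- With `a`, `b` the two errors, `(a - b)² / 4 ≤ (a² + b²) / 2 ≤ a² + b² / 2`.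
  rw [hd]
  nlinarith [sq_nonneg ((t o - I.value lam g) + (t o - J.value lam g)),
    sq_nonneg (t o - I.value lam g)]

/-- The two-point bound for a nonnegative bound on the shift of the conditional means. -/
theorem abs_shift_lower_bound [SigmaFinite lam] {g : X → A → ℝ}
    (hg : Measurable (Function.uncurry g)) (B : Behaviour X Y lam n) (I : ProblemInstance X A Y)
    (hval : I.ValueDefined lam g) (hY : ¬ Bornology.IsBounded Y)
    {δ : X → A → ℝ} (hδ : ∀ x a, 0 ≤ δ x a)
    {s : X → A → ℝ} (hs : Measurable (Function.uncurry s)) (hs0 : ∀ x a, 0 ≤ s x a)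
    (hsδ : ∀ x a, s x a ≤ δ x a)
    (hT : ∫⁻ x, ∫⁻ a, ENNReal.ofReal (|g x a| * s x a) ∂lam ∂I.ctx ≠ ⊤) :
    ENNReal.ofReal
        ((∫⁻ x, ∫⁻ a, ENNReal.ofReal (|g x a| * s x a) ∂lam ∂I.ctx).toReal ^ 2 / 32) ≤
      minimaxRisk B g (localClass lam g n δ I) := by
  classical
  set T := ∫⁻ x, ∫⁻ a, ENNReal.ofReal (|g x a| * s x a) ∂lam ∂I.ctx with hTdef
  set D : Set (X × A) := {p | 0 ≤ g p.1 p.2} with hD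
  have hDm : MeasurableSet D := measurableSet_le measurable_const hg
  -- The direction `e` of the shift is imposed by `Y`, so it cannot follow the sign of `g`. Shifting
  -- only where `g` keeps one sign avoids cancellation; the better of the two regions retains half
  -- of `T`, turning `T² / 8` into `T² / 32`.
  set s₁ : X → A → ℝ := fun x a => if 0 ≤ g x a then s x a else 0 with hs₁
  set s₂ : X → A → ℝ := fun x a => if 0 ≤ g x a then 0 else s x a with hs₂
  have hm₁ : Measurable (Function.uncurry s₁) := Measurable.ite hDm hs measurable_const
  have hm₂ : Measurable (Function.uncurry s₂) := Measurable.ite hDm measurable_const hs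
  have h0₁ : ∀ x a, 0 ≤ s₁ x a := fun x a => by simp only [hs₁]; split_ifs <;> simp [hs0]
  have h0₂ : ∀ x a, 0 ≤ s₂ x a := fun x a => by simp only [hs₂]; split_ifs <;> simp [hs0]
  have hle₁ : ∀ x a, s₁ x a ≤ s x a := fun x a => by
    simp only [hs₁]; split_ifs <;> simp [hs0]
  have hle₂ : ∀ x a, s₂ x a ≤ s x a := fun x a => by
    simp only [hs₂]; split_ifs <;> simp [hs0]
  have hsum : ∀ x a, s x a = s₁ x a + s₂ x a := fun x a => by
    simp only [hs₁, hs₂]; split_ifs <;> simp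
  set T₁ := ∫⁻ x, ∫⁻ a, ENNReal.ofReal (|g x a| * s₁ x a) ∂lam ∂I.ctx with hT₁
  set T₂ := ∫⁻ x, ∫⁻ a, ENNReal.ofReal (|g x a| * s₂ x a) ∂lam ∂I.ctx with hT₂
  have hT₁' : T₁ ≠ ⊤ := ne_top_of_le_ne_top hT <| lintegral_mono fun x => lintegral_mono fun a =>
    ENNReal.ofReal_le_ofReal (mul_le_mul_of_nonneg_left (hle₁ x a) (abs_nonneg _))
  have hT₂' : T₂ ≠ ⊤ := ne_top_of_le_ne_top hT <| lintegral_mono fun x => lintegral_mono fun a =>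
    ENNReal.ofReal_le_ofReal (mul_le_mul_of_nonneg_left (hle₂ x a) (abs_nonneg _))
  have hm₁' : Measurable fun p : X × A => ENNReal.ofReal (|g p.1 p.2| * s₁ p.1 p.2) :=
    (Measurable.mul (measurable_norm.comp hg) hm₁).ennreal_ofReal
  have hTsum : T = T₁ + T₂ := by
    rw [hT₁, hT₂, ← lintegral_add_left hm₁'.lintegral_prod_right', hTdef]
    refine lintegral_congr fun x => ?_
    refine Eq.trans ?_ (lintegral_add_left (hm₁'.comp (measurable_prodMk_left (x := x))) _)
    refine lintegral_congr fun a => ?_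
    rw [hsum x a, mul_add, ENNReal.ofReal_add (mul_nonneg (abs_nonneg _) (h0₁ x a))
      (mul_nonneg (abs_nonneg _) (h0₂ x a))]
    rfl
  have hreal : T.toReal = T₁.toReal + T₂.toReal := by rw [hTsum, ENNReal.toReal_add hT₁' hT₂']
  have hT0 : 0 ≤ T.toReal := ENNReal.toReal_nonneg
  rcases le_total (T.toReal / 2) T₁.toReal with h | h
  · refine le_trans (ENNReal.ofReal_le_ofReal ?_) (shift_lower_bound hg B I hval hY hδ hm₁ h0₁
      (fun x a => (hle₁ x a).trans (hsδ x a)) (σ := 1) (fun x a => ?_) (by norm_num) hT₁')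
    · have := pow_le_pow_left₀ (by positivity) h 2
      rw [← hT₁]
      linarith
    · simp only [hs₁]
      split_ifs with h
      · rw [abs_of_nonneg h, one_mul]
      · simp
  · refine le_trans (ENNReal.ofReal_le_ofReal ?_) (shift_lower_bound hg B I hval hY hδ hm₂ h0₂
      (fun x a => (hle₂ x a).trans (hsδ x a)) (σ := -1) (fun x a => ?_) (by norm_num) hT₂')
    · have := pow_le_pow_left₀ (by positivity) (show T.toReal / 2 ≤ T₂.toReal by linarith) 2
      rw [← hT₂]
      linarith
    · simp only [hs₂]
      split_ifs with h
      · simp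
      · rw [abs_of_neg (not_le.1 h)]; ring

end OutcomePerturbation

end OffPolicy

/-! ### From the shift to the weighted norm of `σ`. -/

namespace OffPolicy

section OracleVariance

variable {X A : Type*} {Y : Set ℝ} [MeasurableSpace X] [MeasurableSpace A]
  {lam : Measure A} {n : ℕ}

theorem condVar_nonneg (I : ProblemInstance X A Y) (x : X) (a : A) : 0 ≤ I.condVar x a :=
  integral_nonneg fun _ => sq_nonneg _

theorem condSd_sq (I : ProblemInstance X A Y) (x : X) (a : A) :
    I.condSd x a ^ 2 = I.condVar x a :=
  Real.sq_sqrt (condVar_nonneg I x a)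

theorem measurable_condVar (I : ProblemInstance X A Y) :
    Measurable fun p : X × A => I.condVar p.1 p.2 :=
  (StronglyMeasurable.integral_kernel_prod_right' (κ := I.out)
    (f := fun q : (X × A) × Y => ((q.2 : ℝ) - I.mean q.1.1 q.1.2) ^ 2)
    (((measurable_subtype_coe.comp measurable_snd).sub
      ((measurable_mean I).comp measurable_fst)).pow_const 2).stronglyMeasurable).measurable

/-- The summands of the weighted norm as iterated integrals with respect to the base measure. -/
theorem lintegral_actionLaw_eq {g : X → A → ℝ} (hg : Measurable (Function.uncurry g))
    (B : Behaviour X Y lam n) (I : ProblemInstance X A Y) (i : Fin n)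
    (hB : ∀ p a, 0 < (B i).density p a) :
    ∫⁻ p, ENNReal.ofReal (g p.1.2 p.2 ^ 2 * I.condSd p.1.2 p.2 ^ 2 / (B i).density p.1 p.2 ^ 2)
        ∂(actionLaw B I i) =
      ∫⁻ o, ∫⁻ x, ∫⁻ a, ENNReal.ofReal (g x a ^ 2 * I.condVar x a / (B i).density (o, x) a)
        ∂lam ∂I.ctx ∂(trajLaw B I i i.2.le) := by
  simp_rw [condSd_sq]
  have hbm : Measurable fun p : ((Fin i → Obs X A Y) × X) × A => (B i).density p.1 p.2 :=
    (B i).measurable_density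
  have hgm : Measurable fun p : X × A => g p.1 p.2 := hg
  have hm : Measurable fun p : ((Fin i → Obs X A Y) × X) × A =>
      ENNReal.ofReal (g p.1.2 p.2 ^ 2 * I.condVar p.1.2 p.2 / (B i).density p.1 p.2 ^ 2) := by
    have hproj : Measurable fun p : ((Fin i → Obs X A Y) × X) × A => (p.1.2, p.2) := by fun_prop
    exact ((((hgm.comp hproj).pow_const 2).mul ((measurable_condVar I).comp hproj)).div
      (hbm.pow_const 2)).ennreal_ofReal
  rw [actionLaw, lintegral_roundLaw B I i _ hm]
  refine lintegral_congr fun o => lintegral_congr fun x => ?_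
  -- The action law contributes one factor of the density, which cancels one of the two in the
  -- denominator.
  rw [(B i).kernel_eq]
  refine (lintegral_withDensity_eq_lintegral_mul _
    (hbm.comp (measurable_prodMk_left (x := (o, x)))).ennreal_ofReal
    (hm.comp (measurable_prodMk_left (x := (o, x))))).trans ?_
  refine lintegral_congr fun a => ?_
  have hb := hB (o, x) a
  simp only [Pi.mul_apply, Function.comp_apply]
  rw [← ENNReal.ofReal_mul hb.le]
  congr 1
  field_simp

/-- Integrals of the reciprocals of two densities with ratio in `[1/K, K]` agree up to a factor
of `K`, also when one of the densities depends on a random parameter. -/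
theorem lintegral_div_density_compare {H : Type*} [MeasurableSpace H] (P : Measure H)
    [IsProbabilityMeasure P] (ν : Measure X) (lam : Measure A) {K : ℝ} (hK0 : 0 < K)
    {φ : X → A → ℝ} (hφ : ∀ x a, 0 ≤ φ x a) {b : H → X → A → ℝ} {r : X → A → ℝ}
    (hb : ∀ o x a, 0 < b o x a)
    (hK : ∀ o x a, 1 / K ≤ r x a / b o x a ∧ r x a / b o x a ≤ K) :
    ∫⁻ o, ∫⁻ x, ∫⁻ a, ENNReal.ofReal (φ x a / b o x a) ∂lam ∂ν ∂P ≤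
        ENNReal.ofReal K * ∫⁻ x, ∫⁻ a, ENNReal.ofReal (φ x a / r x a) ∂lam ∂ν ∧
      ∫⁻ x, ∫⁻ a, ENNReal.ofReal (φ x a / r x a) ∂lam ∂ν ≤
        ENNReal.ofReal K * ∫⁻ o, ∫⁻ x, ∫⁻ a, ENNReal.ofReal (φ x a / b o x a) ∂lam ∂ν ∂P := by
  -- Positivity of `r` is read off at a point of `H`; such a point is at hand only under the
  -- integral over `P`.
  have hr : ∀ (_ : H) x a, 0 < r x a := fun o x a => by
    have h1 := (hK o x a).1
    rw [le_div_iff₀ (hb o x a)] at h1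
    exact lt_of_lt_of_le (mul_pos (by positivity) (hb o x a)) h1
  have hconst : ∀ c : ℝ≥0∞, c = ∫⁻ _, c ∂P := fun c => by
    rw [lintegral_const, measure_univ, mul_one]
  constructor
  · rw [hconst (ENNReal.ofReal K * _)]
    simp_rw [← lintegral_const_mul' _ _ ENNReal.ofReal_ne_top]
    refine lintegral_mono fun o => lintegral_mono fun x => lintegral_mono fun a => ?_
    simp only
    rw [← ENNReal.ofReal_mul hK0.le]
    refine ENNReal.ofReal_le_ofReal ?_
    have h2 := (hK o x a).2
    rw [div_le_iff₀ (hb o x a)] at h2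
    rw [← mul_div_assoc, div_le_div_iff₀ (hb o x a) (hr o x a)]
    calc _ ≤ φ x a * (K * b o x a) := mul_le_mul_of_nonneg_left h2 (hφ x a)
      _ = _ := by ring
  · rw [hconst (∫⁻ x, ∫⁻ a, ENNReal.ofReal (φ x a / r x a) ∂lam ∂ν)]
    simp_rw [← lintegral_const_mul' _ _ ENNReal.ofReal_ne_top]
    refine lintegral_mono fun o => lintegral_mono fun x => lintegral_mono fun a => ?_
    simp only
    rw [← ENNReal.ofReal_mul hK0.le]
    refine ENNReal.ofReal_le_ofReal ?_
    have h1 := (hK o x a).1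
    rw [div_le_div_iff₀ hK0 (hb o x a), one_mul] at h1
    rw [← mul_div_assoc, div_le_div_iff₀ (hr o x a) (hb o x a)]
    calc _ ≤ φ x a * (r x a * K) := mul_le_mul_of_nonneg_left h1 (hφ x a)
      _ = _ := by ring

theorem lintegral_lintegral_const_mul_sum {ι : Type*} [Fintype ι] (ν : Measure X)
    (lam : Measure A) [SFinite lam] {c : ℝ≥0∞} (hc : c ≠ ⊤) {φ : ι → X → A → ℝ≥0∞}
    (hφ : ∀ i, Measurable fun p : X × A => φ i p.1 p.2) :
    ∫⁻ x, ∫⁻ a, c * ∑ i, φ i x a ∂lam ∂ν = c * ∑ i, ∫⁻ x, ∫⁻ a, φ i x a ∂lam ∂ν := by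
  simp_rw [lintegral_const_mul' _ _ hc]
  rw [← lintegral_finsetSum _ fun i _ => (hφ i).lintegral_prod_right']
  congr 1
  refine lintegral_congr fun x => ?_
  exact lintegral_finsetSum _ fun i _ => (hφ i).comp (measurable_prodMk_left (x := x))

/-- The contribution of the unknown outcome kernel to the minimax risk. -/
theorem outcome_lower_bound [SigmaFinite lam] {K : ℝ} (hK1 : 1 ≤ K)
    (hY : ¬ Bornology.IsBounded Y) (hn : 1 ≤ n) {g : X → A → ℝ}
    (hg : Measurable (Function.uncurry g)) (B : Behaviour X Y lam n) (R : Fin n → Policy X lam)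
    (hK : ∀ (i : Fin n) (o : Fin i → Obs X A Y) (x : X) (a : A),
      1 / K ≤ (R i).density x a / (B i).density (o, x) a ∧
      (R i).density x a / (B i).density (o, x) a ≤ K)
    (I : ProblemInstance X A Y) (hval : I.ValueDefined lam g)
    (hsig : weightedNormSq B g I I.condSd < ⊤)
    {δ : X → A → ℝ} (hδ : ∀ x a, 0 ≤ δ x a)
    (hsize : ∀ (x : X) (a : A) (i : Fin n),
      |g x a| * I.condVar x a /
          ((R i).density x a * √(weightedNormSq B g I I.condSd).toReal) ≤ √(n : ℝ) * δ x a) :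
    ENNReal.ofReal (1 / (32 * K ^ 2)) * (weightedNormSq B g I I.condSd / n) ≤
      minimaxRisk B g (localClass lam g n δ I) := by
  have hK0 : 0 < K := by linarith
  have hn0 : (0 : ℝ) < n := by exact_mod_cast hn
  have hn1 : (n : ℝ≥0∞) ≠ 0 := by simpa using (by omega : n ≠ 0)
  -- A vanishing density would make the quotient `0` by the convention for division by zero, against
  -- the lower bound `1 / K`.
  have hB : ∀ i p a, 0 < (B i).density p a := fun i p a => by
    refine ((B i).density_nonneg p a).lt_of_ne fun h => ?_
    have := (hK i p.1 p.2 a).1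
    rw [← h, div_zero] at this
    exact absurd this (not_le.2 (by positivity))
  set W : Fin n → ℝ≥0∞ := fun i =>
    ∫⁻ o, ∫⁻ x, ∫⁻ a, ENNReal.ofReal (g x a ^ 2 * I.condVar x a / (B i).density (o, x) a)
        ∂lam ∂I.ctx ∂(trajLaw B I i i.2.le) with hW
  set J : Fin n → ℝ≥0∞ := fun i =>
    ∫⁻ x, ∫⁻ a, ENNReal.ofReal (g x a ^ 2 * I.condVar x a / (R i).density x a)
        ∂lam ∂I.ctx with hJ
  set S := weightedNormSq B g I I.condSd with hS
  have hSW : (n : ℝ≥0∞) * S = ∑ i, W i := by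
    rw [hS, weightedNormSq, ← mul_assoc, ENNReal.mul_inv_cancel hn1 (by simp), one_mul]
    exact Finset.sum_congr rfl fun i _ => lintegral_actionLaw_eq hg B I i (hB i)
  have hnum : ∀ x a, 0 ≤ g x a ^ 2 * I.condVar x a := fun x a =>
    mul_nonneg (sq_nonneg _) (condVar_nonneg I x a)
  have hWJ : ∀ i, W i ≤ ENNReal.ofReal K * J i := fun i =>
    (lintegral_div_density_compare (trajLaw B I i i.2.le) I.ctx lam hK0 hnum
      (fun o x a => hB i (o, x) a) (hK i)).1
  have hJW : ∀ i, J i ≤ ENNReal.ofReal K * W i := fun i =>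
    (lintegral_div_density_compare (trajLaw B I i i.2.le) I.ctx lam hK0 hnum
      (fun o x a => hB i (o, x) a) (hK i)).2
  have hSJ : (n : ℝ≥0∞) * S ≤ ENNReal.ofReal K * ∑ i, J i := by
    rw [hSW, Finset.mul_sum]; exact Finset.sum_le_sum fun i _ => hWJ i
  have hJtop : ∑ i, J i ≠ ⊤ := by
    refine ne_top_of_le_ne_top (b := ENNReal.ofReal K * (n * S)) (by finiteness) ?_
    rw [hSW, Finset.mul_sum]
    exact Finset.sum_le_sum fun i _ => hJW i
  -- Here `σ` is the square `‖σ‖²_(n)`; the norm itself is `√σ`.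
  set σ := S.toReal with hσ
  have hSσ : S = ENNReal.ofReal σ := (ENNReal.ofReal_toReal hsig.ne).symm
  rcases (ENNReal.toReal_nonneg : 0 ≤ S.toReal).eq_or_lt with hσ0 | hσ0
  · rw [hSσ, hσ, ← hσ0]; simp
  rw [← hσ] at hσ0
  set j := (∑ i, J i).toReal with hj
  have hσj : n * σ ≤ K * j := by
    have := ENNReal.toReal_mono (by finiteness) hSJ
    simpa [ENNReal.toReal_mul, hK0.le] using this
  have hsσ : 0 < √σ := Real.sqrt_pos.2 hσ0
  have hsn : 0 < √(n : ℝ) := Real.sqrt_pos.2 hn0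
  -- The size condition allows a shift for each round `i`; their average is still at most `δ`, and
  -- pairing it with `|g|` reproduces the sum over rounds of the weighted norm.
  set s : X → A → ℝ := fun x a =>
    (∑ i, |g x a| * I.condVar x a / ((R i).density x a * √σ)) / (n * √(n : ℝ)) with hs
  have hgm : Measurable fun p : X × A => g p.1 p.2 := hg
  have hRm : ∀ i, Measurable fun p : X × A => (R i).density p.1 p.2 :=
    fun i => (R i).measurable_density
  have hsm : Measurable (Function.uncurry s) :=
    Measurable.div_const (Finset.measurable_sum _ fun i _ =>
      ((measurable_norm.comp hgm).mul (measurable_condVar I)).div ((hRm i).mul_const _)) _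
  have hs0 : ∀ x a, 0 ≤ s x a := fun x a =>
    div_nonneg (Finset.sum_nonneg fun i _ => div_nonneg
      (mul_nonneg (abs_nonneg _) (condVar_nonneg I x a))
      (mul_nonneg ((R i).density_nonneg x a) hsσ.le)) (by positivity)
  have hsδ : ∀ x a, s x a ≤ δ x a := fun x a => by
    rw [hs, div_le_iff₀ (by positivity)]
    calc _ ≤ ∑ _i : Fin n, √(n : ℝ) * δ x a := Finset.sum_le_sum fun i _ => hsize x a i
      _ = δ x a * (n * √(n : ℝ)) := by
        rw [Finset.sum_const, Finset.card_univ, Fintype.card_fin, nsmul_eq_mul]; ring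
  set c : ℝ := 1 / (n * √(n : ℝ) * √σ) with hc
  have hc0 : 0 < c := by positivity
  have hgs : ∀ x a, ENNReal.ofReal (|g x a| * s x a) = ENNReal.ofReal c *
      ∑ i, ENNReal.ofReal (g x a ^ 2 * I.condVar x a / (R i).density x a) := fun x a => by
    rw [← ENNReal.ofReal_sum_of_nonneg fun i _ =>
        div_nonneg (hnum x a) ((R i).density_nonneg x a), ← ENNReal.ofReal_mul hc0.le]
    congr 1
    simp only [hs, hc]
    rw [Finset.sum_div, Finset.mul_sum, Finset.mul_sum]
    refine Finset.sum_congr rfl fun i _ => ?_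
    rw [← sq_abs (g x a)]
    simp only [div_eq_mul_inv, mul_inv]
    ring
  have hm : ∀ i, Measurable fun p : X × A =>
      ENNReal.ofReal (g p.1 p.2 ^ 2 * I.condVar p.1 p.2 / (R i).density p.1 p.2) := fun i =>
    (((hgm.pow_const 2).mul (measurable_condVar I)).div (hRm i)).ennreal_ofReal
  have hT : ∫⁻ x, ∫⁻ a, ENNReal.ofReal (|g x a| * s x a) ∂lam ∂I.ctx
      = ENNReal.ofReal c * ∑ i, J i := by
    rw [lintegral_congr fun x => lintegral_congr (hgs x)]
    exact lintegral_lintegral_const_mul_sum I.ctx lam ENNReal.ofReal_ne_top hm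
  refine le_trans ?_ (abs_shift_lower_bound hg B I hval hY hδ hsm hs0 hsδ
    (hT.trans_ne (ENNReal.mul_ne_top ENNReal.ofReal_ne_top hJtop)))
  rw [hT, ENNReal.toReal_mul, ENNReal.toReal_ofReal hc0.le, ← hj, hSσ, ← ENNReal.ofReal_natCast,
    ← ENNReal.ofReal_div_of_pos hn0, ← ENNReal.ofReal_mul (by positivity)]
  refine ENNReal.ofReal_le_ofReal ?_
  -- Thus `T = c j ≥ √σ / (K √n)`.
  have hlow : c * (n * σ / K) ≤ c * j := by
    gcongr
    rw [div_le_iff₀ hK0, mul_comm j K]; exact hσj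
  have hsq := pow_le_pow_left₀ (by positivity) hlow 2
  have heq : (c * (n * σ / K)) ^ 2 = σ / n / K ^ 2 := by
    have h1 : √(n : ℝ) ^ 2 = n := Real.sq_sqrt hn0.le
    have h2 : √σ ^ 2 = σ := Real.sq_sqrt hσ0.le
    rw [hc, mul_pow, div_pow, div_pow, mul_pow, mul_pow, mul_pow, h1, h2]
    field_simp
  rw [heq] at hsq
  calc 1 / (32 * K ^ 2) * (σ / n) = σ / n / K ^ 2 / 32 := by field_simp
    _ ≤ _ := by gcongr

end OracleVariance

end OffPolicy

/-! ### Combination of the two bounds. -/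

theorem mainTheorem2 :
    ∀ K : ℝ, 1 ≤ K → ∃ C : ℝ, 0 < C ∧
      ∀ (X A : Type*) [MeasurableSpace X] [MeasurableSpace A]
        (Y : Set ℝ) (_hY : ¬ Bornology.IsBounded Y)
        (lam : Measure A) [SigmaFinite lam]
        (n : ℕ) (_hn : 1 ≤ n)
        (g : X → A → ℝ) (_hg : Measurable (Function.uncurry g))
        -- the behaviour policies and the reference Markov policies
        (B : OffPolicy.Behaviour X Y lam n)
        (R : Fin n → OffPolicy.Policy X lam)
        (_hK : ∀ (i : Fin n) (o : Fin i → OffPolicy.Obs X A Y) (x : X) (a : A),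
          1 / K ≤ (R i).density x a / (B i).density (o, x) a ∧
          (R i).density x a / (B i).density (o, x) a ≤ K)
        -- the ground-truth instance
        (I₀ : OffPolicy.ProblemInstance X A Y)
        (_hvar : ∀ x a, MemLp (fun y : Y => (y : ℝ)) 2 (I₀.out (x, a)))
        (_hval : I₀.ValueDefined lam g)
        (_hsig : OffPolicy.weightedNormSq B g I₀ I₀.condSd < ⊤)
        -- the moment ratio condition
        (_hmem : MemLp (I₀.centredValue lam g) 4 I₀.ctx)
        (_hratio : OffPolicy.momentRatio I₀.ctx (I₀.centredValue lam g) < ⊤)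
        -- the neighbourhood size condition
        (δ : X → A → ℝ) (_hδ : ∀ x a, 0 ≤ δ x a)
        (_hsize : ∀ (x : X) (a : A) (i : Fin n),
          |g x a| * I₀.condVar x a /
              ((R i).density x a * √(OffPolicy.weightedNormSq B g I₀ I₀.condSd).toReal) ≤
            √(n : ℝ) * δ x a),
        ENNReal.ofReal C * (OffPolicy.oracleVariance B g I₀ / n) ≤
          OffPolicy.minimaxRisk B g (OffPolicy.localClass lam g n δ I₀) := by
  intro K hK1
  -- Half the risk is spent on each term, giving constants `1/512` and `1/(64 K²)`; both are at
  -- least `1/(512 K²)` because `K ≥ 1`.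
  refine ⟨1 / (512 * K ^ 2), by positivity, ?_⟩
  intro X A _ _ Y hY lam _ n hn g hg B R hK I₀ _ hval hsig hmem _ δ hδ hsize
  set M := OffPolicy.minimaxRisk B g (OffPolicy.localClass lam g n δ I₀)
  have h1 := OffPolicy.context_lower_bound hn hg B I₀ hval
    (hmem.mono_exponent (by norm_num)) hδ
  have h2 := OffPolicy.outcome_lower_bound hK1 hY hn hg B R hK I₀ hval hsig hδ hsize
  have hK2 : 1 ≤ K ^ 2 := one_le_pow₀ hK1
  have hhalf : ENNReal.ofReal (1 / 2) * M + ENNReal.ofReal (1 / 2) * M = M := by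
    rw [← add_mul, ← ENNReal.ofReal_add (by norm_num) (by norm_num)]
    norm_num
  rw [OffPolicy.oracleVariance, ENNReal.add_div, mul_add, ← hhalf]
  refine add_le_add ?_ ?_
  · calc _ ≤ ENNReal.ofReal (1 / 2) * (ENNReal.ofReal (1 / 256) *
          (evariance (I₀.actionValue lam g) I₀.ctx / n)) := by
          rw [← mul_assoc, ← ENNReal.ofReal_mul (by norm_num)]
          gcongr
          rw [one_div_mul_one_div]
          refine one_div_le_one_div_of_le (by norm_num) ?_
          linarith
      _ ≤ _ := by gcongr
  · calc _ ≤ ENNReal.ofReal (1 / 2) * (ENNReal.ofReal (1 / (32 * K ^ 2)) *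
          (OffPolicy.weightedNormSq B g I₀ I₀.condSd / n)) := by
          rw [← mul_assoc, ← ENNReal.ofReal_mul (by norm_num)]
          gcongr
          rw [one_div_mul_one_div]
          refine one_div_le_one_div_of_le (by positivity) ?_
          linarith
      _ ≤ _ := by gcongr
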